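/- Let $\mathbb{M}_m$ be the algebra of complex $m\times m$ matrices, and for $X\in\mathbb{M}_m$ put $|X|:=(X^*X)^{1/2}$. A norm $\|\cdot\|$ on $\mathbb{M}_m$ is unitarily invariant if $\|UXV\|=\|X\|$ for all $X\in\mathbb{M}_m$ and all unitaries $U,V\in\mathbb{M}_m$. Let $\|\cdot\|$ be a unitarily invariant norm on $\mathbb{M}_m$ and let $r>0$. Adopt throughout either one of the following two conventions for zeroth powers: (a) $A^0:=I$ for positive semidefinite matrices $A$ and $0^0:=1$ for scalars; (b) $A^0:=$ the support projection of $A$ (the orthogonal projection onto its range) for positive semidefinite matrices $A$ and $0^0:=0$ for scalars. In either convention the following hold. (i) Let $A_1,A_2,B_1,B_2\in\mathbb{M}_m$ be positive semidefinite with $A_1A_2=A_2A_1$ and $B_1B_2=B_2B_1$. Then for every $\theta\in[0,1]$, $$\big\|\,\big|(A_1^\theta A_2^{1-\theta})(B_1^\theta B_2^{1-\theta})\big|^r\big\|\le\big\|\,|A_1B_1|^r\big\|^\theta\,\big\|\,|A_2B_2|^r\big\|^{1-\theta}.$$ (ii) Consequently, for all positive semidefinite $A,B\in\mathbb{M}_m$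 the function $(\alpha,\beta)\mapsto\|\,|A^\alpha B^\beta|^r\|$ is jointly log-convex on $[0,\infty)^2$, that is, for all $\alpha_1,\alpha_2,\beta_1,\beta_2\ge0$ and $0<\theta<1$, $$\big\|\,|A^{\theta\alpha_1+(1-\theta)\alpha_2}B^{\theta\beta_1+(1-\theta)\beta_2}|^r\big\|\le\big\|\,|A^{\alpha_1}B^{\beta_1}|^r\big\|^\theta\,\big\|\,|A^{\alpha_2}B^{\beta_2}|^r\big\|^{1-\theta}.$$ -/

import Mathlib

open scoped ComplexOrder MatrixOrder

/-- A norm on the complex `m × m` matrices (a seminorm which vanishes only at `0`) is unitarily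
invariant if `‖U X V‖ = ‖X‖` for all matrices `X` and all unitaries `U`, `V`. -/
structure IsUnitarilyInvariantNorm {m : ℕ}
    (N : Seminorm ℂ (Matrix (Fin m) (Fin m) ℂ)) : Prop where
  eq_zero_of_map_eq_zero : ∀ X, N X = 0 → X = 0
  unitarily_invariant : ∀ U ∈ Matrix.unitaryGroup (Fin m) ℂ,
    ∀ V ∈ Matrix.unitaryGroup (Fin m) ℂ, ∀ X, N (U * X * V) = N X

/-- The two conventions for zeroth powers: either `A ^ 0` is the identity matrix and `0 ^ 0 = 1`
for scalars, or `A ^ 0` is the support projection of `A` and `0 ^ 0 = 0` for scalars. -/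
inductive ZeroPowConvention
  | identity
  | support

namespace ZeroPowConvention

/-- The power `x ^ t` of scalars `x, t ≥ 0`, in the chosen convention for `0 ^ 0`. -/
noncomputable def scalarPow : ZeroPowConvention → ℝ → ℝ → ℝ
  | identity, x, t => x ^ t
  | support, x, t => if x = 0 then 0 else x ^ t

/-- The power `A ^ t` of a positive semidefinite matrix `A`, `t ≥ 0`, in the chosen convention for
`A ^ 0`: functional calculus of `x ↦ x ^ t`. In the second convention `A ^ 0` is the sum of the
spectral projections of `A` for the nonzero eigenvalues, that is, the support projection. -/
noncomputable def matrixPow (c : ZeroPowConvention) {m : ℕ} (A : Matrix (Fin m) (Fin m) ℂ)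
    (t : ℝ) : Matrix (Fin m) (Fin m) ℂ :=
  cfc (fun x : ℝ => c.scalarPow x t) A

end ZeroPowConvention

/-- The matrix `|X| ^ r`, where `|X| = (X* X) ^ (1/2)`; used for `r > 0`. -/
noncomputable def absPow {m : ℕ} (X : Matrix (Fin m) (Fin m) ℂ) (r : ℝ) :
    Matrix (Fin m) (Fin m) ℂ :=
  CFC.rpow (CFC.abs X) r

/-- A nonnegative function `f` on a convex set `s` is log-convex if
`f (a x + b y) ≤ f x ^ a * f y ^ b` for all `x, y ∈ s` and all `a, b > 0` with `a + b = 1`. -/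
def LogConvexOn {E : Type*} [AddCommGroup E] [Module ℝ E] (s : Set E) (f : E → ℝ) : Prop :=
  Convex ℝ s ∧ (∀ x ∈ s, 0 ≤ f x) ∧
    ∀ x ∈ s, ∀ y ∈ s, ∀ a b : ℝ, 0 < a → 0 < b → a + b = 1 →
      f (a • x + b • y) ≤ f x ^ a * f y ^ b

/-! For an `m × m` matrix `X` with singular values `s₁ ≥ s₂ ≥ ...`, the minors `det (Qᴴ * X * P)`
over `m × k` contractions `P`, `Q` have modulus at most `s₁ ⋯ sₖ`, and this bound is attained when
it is nonzero (`norm_det_conjTranspose_mul_mul_le`, `exists_norm_det_conjTranspose_mul_mul_eq`).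
These minors play the role of norms of antisymmetric tensor powers.

For fixed `P`, `Q` put `A₁^z A₂^(1-z) B₁^z B₂^(1-z)` in place of `X`; the minor is an entire
function of `z`, bounded on the strip `0 ≤ re z ≤ 1`. Imaginary powers are contractions, so by
commutativity the matrix is `G (A₁ B₁) G'` on `re z = 1` and `G (A₂ B₂) G'` on `re z = 0`, with
contractions `G`, `G'`. The three lines theorem bounds the product of the `k` largest singular
values at `z = θ` by the corresponding geometric mean, for every `k`
(`norm_det_matrixPow_le_interpolation`).

A unitarily invariant norm of `|X|^r` is a symmetric gauge of the numbers `sᵢ^r`. By Hahn–Banach and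
rearrangement the gauge is attained at a decreasing nonnegative weight, against which
log-majorization yields an inequality of sums; Hölder's inequality concludes
(`symmetric_gauge_le_of_prod_le`).

Complex powers vanish on the kernel, so that exponents add without restriction. The identity
convention differs only at `θ = 0, 1`, where the claim is an equality. Log-convexity follows by
interpolating between powers of one matrix, which commute. -/

/-! ### Log-majorization and symmetric gauge functions -/

/-- Abel summation: the pairing of an antitone nonnegative sequence with a sequence whose partial
sums are nonnegative is nonnegative. -/
theorem sum_range_mul_nonneg_of_antitone {u g : ℕ → ℝ} {n : ℕ} (hu : Antitone u)
    (hu0 : ∀ i, 0 ≤ u i) (hg : ∀ k ≤ n, 0 ≤ ∑ i ∈ Finset.range k, g i) :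
    0 ≤ ∑ i ∈ Finset.range n, u i * g i := by
  -- The factor `u k` on the left makes the induction close: lowering it to `u (k + 1)` is harmless
  -- because the partial sums are nonnegative.
  have key : ∀ k ≤ n, u k * ∑ i ∈ Finset.range k, g i ≤ ∑ i ∈ Finset.range k, u i * g i := by
    intro k
    induction k with
    | zero => simp
    | succ k ih =>
      intro hk
      calc u (k + 1) * ∑ i ∈ Finset.range (k + 1), g i
          ≤ u k * ∑ i ∈ Finset.range (k + 1), g i :=
            mul_le_mul_of_nonneg_right (hu k.le_succ) (hg _ hk)
        _ = u k * ∑ i ∈ Finset.range k, g i + u k * g k := by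
            rw [Finset.sum_range_succ, mul_add]
        _ ≤ _ := by
            rw [Finset.sum_range_succ]
            gcongr
            exact ih (by omega)
  exact (mul_nonneg (hu0 n) (hg n le_rfl)).trans (key n le_rfl)

/-- Weak log-majorization implies weak majorization, in weighted form. -/
theorem sum_range_mul_le_of_prod_le {w x y : ℕ → ℝ} {n : ℕ} (hw : Antitone w) (hw0 : ∀ i, 0 ≤ w i)
    (hx : Antitone x) (hx0 : ∀ i, 0 ≤ x i) (hy0 : ∀ i, 0 ≤ y i)
    (h : ∀ k ≤ n, ∏ i ∈ Finset.range k, x i ≤ ∏ i ∈ Finset.range k, y i) :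
    ∑ i ∈ Finset.range n, w i * x i ≤ ∑ i ∈ Finset.range n, w i * y i := by
  induction n with
  | zero => simp
  | succ n ih =>
    -- If the last, smallest entry of `x` is zero, its term drops out; otherwise all entries of `x`
    -- and `y` are positive and logarithms are available.
    rcases (hx0 n).eq_or_lt with h0 | hpos
    · rw [Finset.sum_range_succ, Finset.sum_range_succ, ← h0, mul_zero]
      exact add_le_add (ih fun k hk => h k (by omega)) (mul_nonneg (hw0 n) (hy0 n))
    · have hxpos : ∀ i ∈ Finset.range (n + 1), 0 < x i := fun i hi =>
        hpos.trans_le (hx (by simpa [Nat.lt_succ_iff] using hi))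
      have hprod : 0 < ∏ i ∈ Finset.range (n + 1), y i :=
        (Finset.prod_pos hxpos).trans_le (h _ le_rfl)
      have hypos : ∀ i ∈ Finset.range (n + 1), 0 < y i := fun i hi =>
        (hy0 i).lt_of_ne' (Finset.prod_ne_zero_iff.1 hprod.ne' i hi)
      have key : 0 ≤ ∑ i ∈ Finset.range (n + 1), w i * x i * (Real.log (y i) - Real.log (x i)) := by
        refine sum_range_mul_nonneg_of_antitone (u := fun i => w i * x i)
          (fun i j hij => mul_le_mul (hw hij) (hx hij) (hx0 _) (hw0 _))
          (fun i => mul_nonneg (hw0 i) (hx0 i)) fun k hk => ?_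
        have hsub : Finset.range k ⊆ Finset.range (n + 1) := Finset.range_subset_range.2 hk
        rw [Finset.sum_sub_distrib, ← Real.log_prod fun i hi => (hypos i (hsub hi)).ne',
          ← Real.log_prod fun i hi => (hxpos i (hsub hi)).ne', sub_nonneg]
        exact Real.log_le_log (Finset.prod_pos fun i hi => hxpos i (hsub hi)) (h k hk)
      rw [← sub_nonneg, ← Finset.sum_sub_distrib]
      refine key.trans (Finset.sum_le_sum fun i hi => ?_)
      rw [← mul_sub, mul_assoc]
      refine mul_le_mul_of_nonneg_left ?_ (hw0 i)
      have hxi := hxpos i hi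
      -- From `log t ≤ t - 1` at `t = y / x`: `x (log y - log x) ≤ y - x`.
      have hlog := Real.log_le_sub_one_of_pos (div_pos (hypos i hi) hxi)
      rw [Real.log_div (hypos i hi).ne' hxi.ne'] at hlog
      calc _ ≤ x i * (y i / x i - 1) := mul_le_mul_of_nonneg_left hlog hxi.le
        _ = _ := by field_simp

/-- Weak log-majorization implies weak majorization, in weighted form, for vectors. -/
theorem sum_mul_le_of_prod_castLE_le {m : ℕ} {w x y : Fin m → ℝ} (hw : Antitone w)
    (hw0 : ∀ i, 0 ≤ w i) (hx : Antitone x) (hx0 : ∀ i, 0 ≤ x i) (hy0 : ∀ i, 0 ≤ y i)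
    (h : ∀ (k : ℕ) (hk : k ≤ m), ∏ i : Fin k, x (Fin.castLE hk i) ≤
      ∏ i : Fin k, y (Fin.castLE hk i)) :
    ∑ i, w i * x i ≤ ∑ i, w i * y i := by
  let ext (v : Fin m → ℝ) (i : ℕ) : ℝ := if hi : i < m then v ⟨i, hi⟩ else 0
  have ext0 {v : Fin m → ℝ} (hv : ∀ i, 0 ≤ v i) (i : ℕ) : 0 ≤ ext v i := by
    by_cases hi : i < m <;> simp [ext, hi, hv]
  have extA {v : Fin m → ℝ} (hv : Antitone v) (hv0 : ∀ i, 0 ≤ v i) : Antitone (ext v) := by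
    intro i j hij
    by_cases hj : j < m
    · simp only [ext, hj, hij.trans_lt hj, dif_pos]
      exact hv hij
    · simpa [ext, hj] using ext0 hv0 i
  have hsum (v : Fin m → ℝ) : ∑ i ∈ Finset.range m, ext w i * ext v i = ∑ i, w i * v i := by
    simp [Finset.sum_range, ext]
  have hprod (v : Fin m → ℝ) (k : ℕ) (hk : k ≤ m) :
      ∏ i ∈ Finset.range k, ext v i = ∏ i : Fin k, v (Fin.castLE hk i) := by
    rw [Finset.prod_range]
    refine Finset.prod_congr rfl fun i _ => ?_
    simp only [ext, i.2.trans_le hk, dif_pos]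
    rfl
  rw [← hsum, ← hsum]
  refine sum_range_mul_le_of_prod_le (extA hw hw0) (ext0 hw0) (extA hx hx0) (ext0 hx0) (ext0 hy0)
    fun k hk => ?_
  rw [hprod _ _ hk, hprod _ _ hk]
  exact h k hk

/-- Hölder's inequality for weighted sums, with the exponents `θ` and `1 - θ`. -/
theorem sum_mul_rpow_mul_rpow_le {ι : Type*} [Fintype ι] {w y z : ι → ℝ} (hw : ∀ i, 0 ≤ w i)
    (hy : ∀ i, 0 ≤ y i) (hz : ∀ i, 0 ≤ z i) {θ : ℝ} (h0 : 0 ≤ θ) (h1 : θ ≤ 1) :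
    ∑ i, w i * (y i ^ θ * z i ^ (1 - θ)) ≤
      (∑ i, w i * y i) ^ θ * (∑ i, w i * z i) ^ (1 - θ) := by
  rcases h0.eq_or_lt with rfl | h0
  · simp
  rcases h1.eq_or_lt with rfl | h1
  · simp
  have hpq : (1 / θ).HolderConjugate (1 / (1 - θ)) := by
    rw [Real.holderConjugate_iff]
    refine ⟨by rw [lt_div_iff₀ h0]; linarith, by simp⟩
  have h1' : 0 < 1 - θ := by linarith
  have := Real.inner_le_Lp_mul_Lq_of_nonneg Finset.univ hpq
    (f := fun i => (w i * y i) ^ θ) (g := fun i => (w i * z i) ^ (1 - θ))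
    (fun i _ => Real.rpow_nonneg (mul_nonneg (hw i) (hy i)) _)
    (fun i _ => Real.rpow_nonneg (mul_nonneg (hw i) (hz i)) _)
  convert this using 1
  · refine Finset.sum_congr rfl fun i _ => ?_
    rw [Real.mul_rpow (hw i) (hy i), Real.mul_rpow (hw i) (hz i), mul_mul_mul_comm]
    congr 1
    rw [← Real.rpow_add_of_nonneg (hw i) h0.le h1'.le]
    simp
  · simp only [one_div_one_div]
    congr 2 <;> refine Finset.sum_congr rfl fun i _ => ?_
    · rw [← Real.rpow_mul (mul_nonneg (hw i) (hy i)), mul_one_div_cancel h0.ne', Real.rpow_one]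
    · rw [← Real.rpow_mul (mul_nonneg (hw i) (hz i)), mul_one_div_cancel h1'.ne', Real.rpow_one]

/-- A seminorm on vectors which is invariant under permutations and changes of sign is normed at
an antitone nonnegative vector by an antitone nonnegative weight in the dual unit ball. -/
theorem exists_antitone_dual_weight {m : ℕ} (p : Seminorm ℝ (Fin m → ℝ))
    (hperm : ∀ (σ : Equiv.Perm (Fin m)) (x : Fin m → ℝ), p (x ∘ σ) = p x)
    (hsign : ∀ ε : Fin m → ℝ, (∀ i, |ε i| = 1) → ∀ x, p (ε * x) = p x)
    {x : Fin m → ℝ} (hx : Antitone x) (hx0 : ∀ i, 0 ≤ x i) :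
    ∃ w : Fin m → ℝ, Antitone w ∧ (∀ i, 0 ≤ w i) ∧ p x ≤ ∑ i, w i * x i ∧
      ∀ y, ∑ i, w i * y i ≤ p y := by
  rcases eq_or_ne x 0 with rfl | hne
  · exact ⟨0, antitone_const, fun _ => le_rfl, by simp, fun y => by simp⟩
  -- Hahn–Banach: extend `c x ↦ c * p x` from the line through `x`, staying below `p`.
  obtain ⟨g, hg1, hg2⟩ := exists_extension_of_le_sublinear
    (LinearPMap.mkSpanSingleton x (p x) hne) p
    (fun c hc y => by rw [map_smul_eq_mul, Real.norm_of_nonneg hc.le])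
    (fun y z => map_add_le_add p y z) (by
      rintro ⟨y, hy⟩
      obtain ⟨c, rfl⟩ := Submodule.mem_span_singleton.1 hy
      simp only [LinearPMap.mkSpanSingleton'_apply, map_smul_eq_mul, RingHom.id_apply,
        smul_eq_mul]
      exact mul_le_mul_of_nonneg_right (le_abs_self c) (apply_nonneg p x))
  have hgx : g x = p x := by
    have := hg1 ⟨x, Submodule.mem_span_singleton_self x⟩
    rwa [LinearPMap.mkSpanSingleton_apply] at this
  let v : Fin m → ℝ := fun i => g (Pi.single i 1)
  have hgv (y : Fin m → ℝ) : g y = ∑ i, v i * y i := by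
    rw [LinearMap.pi_apply_eq_sum_univ g y]
    refine Finset.sum_congr rfl fun i _ => ?_
    rw [smul_eq_mul, mul_comm]
    congr 2
    ext j
    simp [Pi.single_apply, eq_comm]
  let σ := Tuple.sort fun i => -|v i|
  have hσ : Monotone ((fun i => -|v i|) ∘ σ) := Tuple.monotone_sort _
  have hwa : Antitone fun i => |v (σ i)| := fun i j hij => by simpa using hσ hij
  refine ⟨fun i => |v (σ i)|, hwa, fun i => abs_nonneg _, ?_, fun y => ?_⟩
  · rw [← hgx, hgv]
    calc ∑ i, v i * x i ≤ ∑ i, |v i| * x i :=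
          Finset.sum_le_sum fun i _ => mul_le_mul_of_nonneg_right (le_abs_self _) (hx0 i)
      _ = ∑ i, |v (σ (σ.symm i))| * x i := by simp
      -- Rearrangement inequality: sorting the weight like `x` can only increase the pairing.
      _ ≤ _ := Monovary.sum_comp_perm_mul_le_sum_mul (σ := σ.symm) (f := fun i => |v (σ i)|)
          (hwa.monovary hx)
  -- Both the signs of `v` and the sorting are moved onto `y`, where `p` does not see them.
  · let ε : Fin m → ℝ := fun i => if 0 ≤ v i then 1 else -1
    have hε : ∀ i, |ε i| = 1 := fun i => by by_cases h : 0 ≤ v i <;> simp [ε, h]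
    have hvε : ∀ i, |v i| = v i * ε i := fun i => by
      by_cases h : 0 ≤ v i
      · simp [ε, h, abs_of_nonneg h]
      · simp [ε, h, abs_of_neg (not_le.1 h)]
    calc ∑ i, |v (σ i)| * y i = ∑ i, |v i| * y (σ.symm i) := by
          rw [← Equiv.sum_comp σ fun i => |v i| * y (σ.symm i)]
          simp
      _ = g (ε * (y ∘ σ.symm)) := by
          rw [hgv]
          refine Finset.sum_congr rfl fun i _ => ?_
          rw [hvε]
          simp [mul_assoc]
      _ ≤ p (ε * (y ∘ σ.symm)) := hg2 _
      _ = p y := by rw [hsign ε hε, hperm]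

/-- Symmetric gauge functions are monotone and log-convex with respect to weak log-majorization. -/
theorem symmetric_gauge_le_of_prod_le {m : ℕ} (p : Seminorm ℝ (Fin m → ℝ))
    (hperm : ∀ (σ : Equiv.Perm (Fin m)) (x : Fin m → ℝ), p (x ∘ σ) = p x)
    (hsign : ∀ ε : Fin m → ℝ, (∀ i, |ε i| = 1) → ∀ x, p (ε * x) = p x)
    {x y z : Fin m → ℝ} (hx : Antitone x) (hx0 : ∀ i, 0 ≤ x i) (hy0 : ∀ i, 0 ≤ y i)
    (hz0 : ∀ i, 0 ≤ z i) {θ : ℝ} (h0 : 0 ≤ θ) (h1 : θ ≤ 1)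
    (h : ∀ (k : ℕ) (hk : k ≤ m), ∏ i : Fin k, x (Fin.castLE hk i) ≤
      ∏ i : Fin k, (y (Fin.castLE hk i) ^ θ * z (Fin.castLE hk i) ^ (1 - θ))) :
    p x ≤ p y ^ θ * p z ^ (1 - θ) := by
  obtain ⟨w, hw, hw0, hwx, hwp⟩ := exists_antitone_dual_weight p hperm hsign hx hx0
  have hwnn {v : Fin m → ℝ} (hv : ∀ i, 0 ≤ v i) : 0 ≤ ∑ i, w i * v i :=
    Finset.sum_nonneg fun i _ => mul_nonneg (hw0 i) (hv i)
  calc p x ≤ ∑ i, w i * x i := hwx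
    _ ≤ ∑ i, w i * (y i ^ θ * z i ^ (1 - θ)) :=
        sum_mul_le_of_prod_castLE_le hw hw0 hx hx0
          (fun i => mul_nonneg (Real.rpow_nonneg (hy0 i) _) (Real.rpow_nonneg (hz0 i) _)) h
    _ ≤ _ := sum_mul_rpow_mul_rpow_le hw0 hy0 hz0 h0 h1
    _ ≤ _ := mul_le_mul (Real.rpow_le_rpow (hwnn hy0) (hwp y) h0)
        (Real.rpow_le_rpow (hwnn hz0) (hwp z) (by linarith)) (Real.rpow_nonneg (hwnn hz0) _)
        (Real.rpow_nonneg (apply_nonneg p y) _)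

/-! ### Minors in contractive frames and products of singular values -/

section Determinants

open Matrix

theorem Matrix.PosSemidef.one_le_det_one_add {n : Type*} [Fintype n] [DecidableEq n]
    {P : Matrix n n ℂ} (hP : P.PosSemidef) : 1 ≤ (1 + P).det := by
  have hdet : (1 + P).det = ((∏ i, (1 + hP.1.eigenvalues i) : ℝ) : ℂ) := by
    have h1 : 1 + P = Unitary.conjStarAlgAut ℂ _ hP.1.eigenvectorUnitary
        (diagonal fun i => ((1 + hP.1.eigenvalues i : ℝ) : ℂ)) := by
      conv_lhs => rw [hP.1.spectral_theorem]
      rw [← map_one (Unitary.conjStarAlgAut ℂ _ hP.1.eigenvectorUnitary), ← map_add,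
        ← diagonal_one, diagonal_add]
      simp
    rw [h1, Unitary.conjStarAlgAut_apply, det_mul_right_comm,
      Unitary.mul_star_self_of_mem hP.1.eigenvectorUnitary.2, one_mul, det_diagonal]
    push_cast
    rfl
  rw [hdet, ← Complex.ofReal_one, Complex.real_le_real]
  exact Finset.one_le_prod fun i _ => by linarith [hP.eigenvalues_nonneg i]

/-- The determinant is monotone on positive semidefinite matrices. -/
theorem Matrix.PosSemidef.det_le_det {n : Type*} [Fintype n] [DecidableEq n]
    {A B : Matrix n n ℂ} (hA : A.PosSemidef) (hAB : A ≤ B) : A.det ≤ B.det := by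
  have hBA : (B - A).PosSemidef := hAB
  by_cases h0 : A.det = 0
  · rw [h0]
    have := (hA.add hBA).det_nonneg
    rwa [add_sub_cancel] at this
  -- With `A` invertible, `B = S (1 + P) S` where `P = S⁻¹ (B - A) S⁻¹` is positive semidefinite, so
  -- `det B = det A * det (1 + P)`.
  set S := CFC.sqrt A with hS
  have hSS : S * S = A := CFC.sqrt_mul_sqrt_self A hA.nonneg
  have hSh : S.IsHermitian := (CFC.sqrt_nonneg A).posSemidef.1
  have hSdet : IsUnit S.det := by
    refine isUnit_iff_ne_zero.2 fun h => h0 ?_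
    rw [← hSS, det_mul, h, zero_mul]
  have hP : (S⁻¹ * (B - A) * S⁻¹).PosSemidef := by
    have := hBA.conjTranspose_mul_mul_same S⁻¹
    rwa [conjTranspose_nonsing_inv, hSh.eq] at this
  have hB : B = S * (1 + S⁻¹ * (B - A) * S⁻¹) * S := by
    have h1 : S * (S⁻¹ * (B - A) * S⁻¹) * S = (S * S⁻¹) * (B - A) * (S⁻¹ * S) := by
      simp only [Matrix.mul_assoc]
    rw [Matrix.mul_add, Matrix.add_mul, h1, mul_nonsing_inv _ hSdet, nonsing_inv_mul _ hSdet]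
    simp [hSS]
  have hdet : B.det = A.det * (1 + S⁻¹ * (B - A) * S⁻¹).det := by
    conv_lhs => rw [hB]
    rw [det_mul, det_mul, ← hSS, det_mul]
    ring
  rw [hdet]
  exact le_mul_of_one_le_right hA.det_nonneg hP.one_le_det_one_add

theorem Matrix.conjTranspose_mul_mul_mono {n k : Type*} [Fintype n] [Fintype k] {A B : Matrix n n ℂ}
    (hAB : A ≤ B) (V : Matrix n k ℂ) : Vᴴ * A * V ≤ Vᴴ * B * V := by
  have h : (B - A).PosSemidef := hAB
  rw [Matrix.le_iff, ← Matrix.sub_mul, ← Matrix.mul_sub]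
  exact h.conjTranspose_mul_mul_same V

open scoped Matrix.Norms.L2Operator

theorem Matrix.conjTranspose_mul_self_le_one {n k : Type*} [Fintype n] [Fintype k] [DecidableEq k]
    {V : Matrix n k ℂ} (hV : ‖V‖ ≤ 1) : Vᴴ * V ≤ 1 := by
  refine (CStarAlgebra.norm_le_one_iff_of_nonneg (Vᴴ * V)
    (posSemidef_conjTranspose_mul_self V).nonneg).1 ?_
  rw [l2_opNorm_conjTranspose_mul_self]
  exact mul_le_one₀ hV (norm_nonneg _) hV

theorem Matrix.norm_le_one_of_conjTranspose_mul_self {n k : Type*} [Fintype n] [Fintype k]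
    [DecidableEq k] {V : Matrix n k ℂ} (hV : Vᴴ * V = 1) : ‖V‖ ≤ 1 := by
  have h1 : ‖V‖ * ‖V‖ ≤ 1 := by
    rw [← l2_opNorm_conjTranspose_mul_self, hV, ← diagonal_one, l2_opNorm_diagonal]
    exact (pi_norm_le_iff_of_nonneg zero_le_one).2 fun i => by simp
  nlinarith [norm_nonneg V]

/-- The determinant of a compression of a nonnegative diagonal matrix by a contraction. -/
theorem Matrix.det_conjTranspose_mul_diagonal_mul_le {n k : Type*} [Fintype n] [DecidableEq n]
    [Fintype k] [DecidableEq k] {V : Matrix n k ℂ} (hV : ‖V‖ ≤ 1) {d : n → ℝ} (hd : ∀ i, 0 ≤ d i)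
    {t : ℝ} (ht : 0 < t) :
    (Vᴴ * diagonal (fun i => (d i : ℂ)) * V).det ≤
      ((t ^ Fintype.card k * ∏ i, (1 + max (d i - t) 0 / t) : ℝ) : ℂ) := by
  -- The least nonnegative `s` with `d ≤ t (1 + s)`. Writing `s` as the square of `R`, the identity
  -- `det (1 + XY) = det (1 + YX)` brings in `V Vᴴ ≤ 1`, leaving a diagonal determinant.
  let s : n → ℝ := fun i => max (d i - t) 0 / t
  have hs : ∀ i, 0 ≤ s i := fun i => div_nonneg (le_max_right _ _) ht.le
  have hds : ∀ i, d i ≤ t * (1 + s i) := fun i => by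
    have : t * s i = max (d i - t) 0 := mul_div_cancel₀ _ ht.ne'
    rw [mul_add, this]
    linarith [le_max_left (d i - t) 0]
  let R : Matrix n n ℂ := diagonal fun i => (Real.sqrt (s i) : ℂ)
  have hRR : R * R = diagonal fun i => (s i : ℂ) := by
    rw [diagonal_mul_diagonal]
    congr 1
    ext i
    rw [← Complex.ofReal_mul, Real.mul_self_sqrt (hs i)]
  have hRh : Rᴴ = R := by
    rw [diagonal_conjTranspose]
    congr 1
    ext i
    simp
  have hD : diagonal (fun i => (d i : ℂ)) ≤ (t : ℂ) • (1 + R * R) := by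
    rw [Matrix.le_iff, hRR, ← diagonal_one, diagonal_add, ← diagonal_smul, diagonal_sub]
    refine PosSemidef.diagonal fun i => ?_
    have : (0 : ℂ) ≤ ((t * (1 + s i) - d i : ℝ) : ℂ) := by
      rw [← Complex.ofReal_zero, Complex.real_le_real]
      linarith [hds i]
    simpa using this
  have hVV : Vᴴ * V ≤ 1 := conjTranspose_mul_self_le_one hV
  have hVV' : V * Vᴴ ≤ 1 := by
    have := conjTranspose_mul_self_le_one (V := Vᴴ) (by rwa [l2_opNorm_conjTranspose])
    rwa [conjTranspose_conjTranspose] at this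
  have htC : (0 : ℂ) ≤ (t : ℂ) := by
    rw [← Complex.ofReal_zero, Complex.real_le_real]; exact ht.le
  have hpsd : (Vᴴ * diagonal (fun i => (d i : ℂ)) * V).PosSemidef :=
    PosSemidef.conjTranspose_mul_mul_same (PosSemidef.diagonal fun i => by simpa using hd i) V
  have h1 : Vᴴ * diagonal (fun i => (d i : ℂ)) * V ≤ (t : ℂ) • (1 + (Vᴴ * R) * (R * V)) := by
    refine (conjTranspose_mul_mul_mono hD V).trans ?_
    have h2 : (1 - Vᴴ * V).PosSemidef := hVV
    rw [Matrix.le_iff]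
    have h3 : (t : ℂ) • (1 + (Vᴴ * R) * (R * V)) - Vᴴ * ((t : ℂ) • (1 + R * R)) * V =
        (t : ℂ) • (1 - Vᴴ * V) := by
      simp only [Matrix.mul_smul, Matrix.smul_mul, Matrix.mul_add, Matrix.add_mul, Matrix.mul_one,
        Matrix.mul_assoc, smul_add, smul_sub]
      abel
    rw [h3]
    exact h2.smul htC
  have h3 : 1 + (R * V) * (Vᴴ * R) ≤ 1 + R * R := by
    have := conjTranspose_mul_mul_mono hVV' R
    rw [hRh, Matrix.mul_one] at this
    have h4 : (R * V) * (Vᴴ * R) = R * (V * Vᴴ) * R := by simp only [Matrix.mul_assoc]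
    rw [h4]
    exact add_le_add_right this 1
  have h5 : (1 + (R * V) * (Vᴴ * R)).PosSemidef := by
    refine PosSemidef.one.add ?_
    have := posSemidef_self_mul_conjTranspose (R * V)
    rwa [conjTranspose_mul, hRh] at this
  calc (Vᴴ * diagonal (fun i => (d i : ℂ)) * V).det
      ≤ ((t : ℂ) • (1 + (Vᴴ * R) * (R * V))).det := hpsd.det_le_det h1
    _ = (t : ℂ) ^ Fintype.card k * (1 + (R * V) * (Vᴴ * R)).det := by
        rw [det_smul, det_one_add_mul_comm]
    _ ≤ (t : ℂ) ^ Fintype.card k * (1 + R * R).det :=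
        mul_le_mul_of_nonneg_left (h5.det_le_det h3) (pow_nonneg htC _)
    _ = _ := by
        rw [hRR, ← diagonal_one, diagonal_add, det_diagonal]
        simp [s]

theorem Fin.prod_eq_prod_castLE_of_eq_one {m k : ℕ} (hk : k ≤ m) {f : Fin m → ℝ}
    (hf : ∀ i : Fin m, k ≤ i → f i = 1) : ∏ i, f i = ∏ i : Fin k, f (Fin.castLE hk i) := by
  have := Finset.prod_map Finset.univ (Fin.castLEEmb hk) f
  rw [Fin.coe_castLEEmb] at this
  rw [← this]
  refine (Finset.prod_subset (Finset.subset_univ _) fun i _ hi => hf i ?_).symm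
  by_contra! h
  exact hi (Finset.mem_map.2 ⟨⟨i, h⟩, Finset.mem_univ _, rfl⟩)

/-- The determinant of a `k × k` compression of a diagonal matrix is at most the product of the
`k` largest diagonal entries. -/
theorem Matrix.det_conjTranspose_mul_diagonal_mul_le_prod {m k : ℕ} (hk : k ≤ m)
    {V : Matrix (Fin m) (Fin k) ℂ} (hV : ‖V‖ ≤ 1) {d : Fin m → ℝ} (hd : ∀ i, 0 ≤ d i)
    (hda : Antitone d) :
    (Vᴴ * diagonal (fun i => (d i : ℂ)) * V).det ≤
      ((∏ i : Fin k, d (Fin.castLE hk i) : ℝ) : ℂ) := by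
  rcases k with _ | k
  · simp
  have hpsd : (Vᴴ * diagonal (fun i => (d i : ℂ)) * V).PosSemidef :=
    PosSemidef.conjTranspose_mul_mul_same (PosSemidef.diagonal fun i => by simpa using hd i) V
  obtain ⟨x, -, hxdet⟩ := (RCLike.nonneg_iff_exists_ofReal (K := ℂ)).1 hpsd.det_nonneg
  have hxdet' : (Vᴴ * diagonal (fun i => (d i : ℂ)) * V).det = (x : ℂ) := hxdet.symm
  rw [hxdet', Complex.real_le_real]
  -- The size is now `k + 1`, so `l` is the last index kept. For `t = d l + ε` the factors beyond
  -- `l` equal `1`; `ε > 0` keeps `t` positive when `d l = 0`.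
  let l : Fin m := ⟨k, hk⟩
  have hle : ∀ ε > 0, x ≤ ∏ i : Fin (k + 1), max (d (Fin.castLE hk i)) (d l + ε) := by
    intro ε hε
    have ht : 0 < d l + ε := by linarith [hd l]
    have h1 := det_conjTranspose_mul_diagonal_mul_le hV hd ht
    rw [hxdet', Complex.real_le_real] at h1
    refine h1.trans_eq ?_
    rw [Fin.prod_eq_prod_castLE_of_eq_one hk, Fintype.card_fin]
    · rw [← Fin.prod_const, ← Finset.prod_mul_distrib]
      refine Finset.prod_congr rfl fun i _ => ?_
      rw [mul_add, mul_div_cancel₀ _ ht.ne', mul_one, ← max_add_add_left]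
      congr 1 <;> ring
    · intro i hi
      have : d i ≤ d l := hda (Fin.le_def.2 (by simp [l]; omega))
      rw [max_eq_right (by linarith), zero_div, add_zero]
  have hcont : Filter.Tendsto (fun ε : ℝ => ∏ i : Fin (k + 1), max (d (Fin.castLE hk i)) (d l + ε))
      (nhdsWithin 0 (Set.Ioi 0)) (nhds (∏ i : Fin (k + 1), max (d (Fin.castLE hk i)) (d l + 0))) :=
    Filter.Tendsto.mono_left (Continuous.tendsto (by fun_prop) 0) nhdsWithin_le_nhds
  refine (ge_of_tendsto hcont (Filter.eventually_of_mem self_mem_nhdsWithin hle)).trans_eq ?_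
  refine Finset.prod_congr rfl fun i _ => ?_
  rw [add_zero, max_eq_left (hda (Fin.le_def.2 (by simp [l]; omega)))]

/-- The `k × k` minors of a matrix with singular values `b`, in contractive frames, are at most the
product of the `k` largest singular values. -/
theorem Matrix.norm_det_conjTranspose_mul_mul_le {m k : ℕ} (hk : k ≤ m)
    {Y U : Matrix (Fin m) (Fin m) ℂ} (hU : U ∈ unitaryGroup (Fin m) ℂ) {b : Fin m → ℝ}
    (hb : ∀ i, 0 ≤ b i) (hba : Antitone b)
    (hY : Yᴴ * Y = U * diagonal (fun i => ((b i ^ 2 : ℝ) : ℂ)) * Uᴴ)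
    {P Q : Matrix (Fin m) (Fin k) ℂ} (hP : ‖P‖ ≤ 1) (hQ : ‖Q‖ ≤ 1) :
    ‖(Qᴴ * Y * P).det‖ ≤ ∏ i : Fin k, b (Fin.castLE hk i) := by
  refine (pow_le_pow_iff_left₀ (norm_nonneg _) (Finset.prod_nonneg fun i _ => hb _)
    two_ne_zero).1 ?_
  have hQQ : Q * Qᴴ ≤ 1 := by
    have := conjTranspose_mul_self_le_one (V := Qᴴ) (by rwa [l2_opNorm_conjTranspose])
    rwa [conjTranspose_conjTranspose] at this
  have hUU : Uᴴ * U = 1 := mem_unitaryGroup_iff'.1 hU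
  have hUn : ‖Uᴴ‖ ≤ 1 := by
    rw [l2_opNorm_conjTranspose]
    exact norm_le_one_of_conjTranspose_mul_self hUU
  have h1 : ((‖(Qᴴ * Y * P).det‖ ^ 2 : ℝ) : ℂ) = ((Qᴴ * Y * P)ᴴ * (Qᴴ * Y * P)).det := by
    rw [det_mul, det_conjTranspose]
    push_cast
    exact (Complex.conj_mul' _).symm
  rw [← Complex.real_le_real, h1, ← Finset.prod_pow]
  calc ((Qᴴ * Y * P)ᴴ * (Qᴴ * Y * P)).det = ((Y * P)ᴴ * (Q * Qᴴ) * (Y * P)).det := by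
        simp only [conjTranspose_mul, conjTranspose_conjTranspose, Matrix.mul_assoc]
    _ ≤ ((Y * P)ᴴ * (1 : Matrix (Fin m) (Fin m) ℂ) * (Y * P)).det := by
        refine PosSemidef.det_le_det ?_ (conjTranspose_mul_mul_mono hQQ _)
        exact (posSemidef_self_mul_conjTranspose Q).conjTranspose_mul_mul_same _
    _ = ((Uᴴ * P)ᴴ * diagonal (fun i => ((b i ^ 2 : ℝ) : ℂ)) * (Uᴴ * P)).det := by
        have : (Y * P)ᴴ * (1 : Matrix (Fin m) (Fin m) ℂ) * (Y * P) = Pᴴ * (Yᴴ * Y) * P := by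
          simp only [conjTranspose_mul, Matrix.mul_one, Matrix.mul_assoc]
        rw [this, hY]
        simp only [conjTranspose_mul, conjTranspose_conjTranspose, Matrix.mul_assoc]
    _ ≤ _ := by
        refine det_conjTranspose_mul_diagonal_mul_le_prod hk ?_ (fun i => sq_nonneg _)
          fun i j hij => pow_le_pow_left₀ (hb _) (hba hij) 2
        exact (l2_opNorm_mul _ _).trans (mul_le_one₀ hUn (norm_nonneg _) hP)

/-- The bound on the minors of a matrix by its largest singular values is attained. -/
theorem Matrix.exists_norm_det_conjTranspose_mul_mul_eq {m k : ℕ} (hk : k ≤ m)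
    {X U : Matrix (Fin m) (Fin m) ℂ} (hU : U ∈ unitaryGroup (Fin m) ℂ) {a : Fin m → ℝ}
    (ha : ∀ i, 0 ≤ a i) (hX : Xᴴ * X = U * diagonal (fun i => ((a i ^ 2 : ℝ) : ℂ)) * Uᴴ)
    (hpos : ∏ i : Fin k, a (Fin.castLE hk i) ≠ 0) :
    ∃ P Q : Matrix (Fin m) (Fin k) ℂ, ‖P‖ ≤ 1 ∧ ‖Q‖ ≤ 1 ∧
      ‖(Qᴴ * X * P).det‖ = ∏ i : Fin k, a (Fin.castLE hk i) := by
  let e : Fin k → Fin m := Fin.castLE hk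
  have he : Function.Injective e := Fin.castLE_injective hk
  have hae (i : Fin k) : (a (e i) : ℂ) ≠ 0 := by
    exact_mod_cast Finset.prod_ne_zero_iff.1 hpos i (Finset.mem_univ i)
  have hUU : Uᴴ * U = 1 := mem_unitaryGroup_iff'.1 hU
  -- The columns of `P` are the right singular vectors for the `k` largest singular values; `Q = X P
  -- D⁻¹` has the left singular vectors, so `Qᴴ X P = D`.
  let P : Matrix (Fin m) (Fin k) ℂ := U.submatrix id e
  let D : Matrix (Fin k) (Fin k) ℂ := diagonal fun i => (a (e i) : ℂ)
  let E : Matrix (Fin k) (Fin k) ℂ := diagonal fun i => (a (e i) : ℂ)⁻¹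
  have hE : Eᴴ = E := by
    rw [diagonal_conjTranspose]
    congr 1
    ext i
    simp
  have hsub (M : Matrix (Fin m) (Fin m) ℂ) : Pᴴ * M * P = (Uᴴ * M * U).submatrix e e := by
    ext i j
    simp [P, Matrix.mul_apply]
  have hPP : Pᴴ * P = 1 := by
    have := hsub 1
    rwa [Matrix.mul_one, Matrix.mul_one, hUU, submatrix_one _ he] at this
  have hXX : Pᴴ * (Xᴴ * X) * P = D * D := by
    have h1 : Uᴴ * (Xᴴ * X) * U = diagonal (fun i => ((a i ^ 2 : ℝ) : ℂ)) := by
      rw [hX]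
      calc _ = (Uᴴ * U) * diagonal (fun i => ((a i ^ 2 : ℝ) : ℂ)) * (Uᴴ * U) := by
            simp only [Matrix.mul_assoc]
        _ = _ := by rw [hUU, Matrix.one_mul, Matrix.mul_one]
    rw [hsub, h1, submatrix_diagonal _ _ he, diagonal_mul_diagonal]
    congr 1
    ext i
    simp [sq]
  have hED : E * D = 1 := by
    rw [diagonal_mul_diagonal, ← diagonal_one]
    congr 1
    ext i
    exact inv_mul_cancel₀ (hae i)
  have hDE : D * E = 1 := mul_eq_one_comm.1 hED
  refine ⟨P, X * P * E, norm_le_one_of_conjTranspose_mul_self hPP,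
    norm_le_one_of_conjTranspose_mul_self ?_, ?_⟩
  · calc (X * P * E)ᴴ * (X * P * E) = E * (Pᴴ * (Xᴴ * X) * P) * E := by
          simp only [conjTranspose_mul, hE, Matrix.mul_assoc]
      _ = (E * D) * (D * E) := by rw [hXX]; simp only [Matrix.mul_assoc]
      _ = 1 := by rw [hED, hDE, Matrix.one_mul]
  · have : (X * P * E)ᴴ * X * P = D := by
      calc (X * P * E)ᴴ * X * P = E * (Pᴴ * (Xᴴ * X) * P) := by
            simp only [conjTranspose_mul, hE, Matrix.mul_assoc]
        _ = (E * D) * D := by rw [hXX, Matrix.mul_assoc]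
        _ = D := by rw [hED, Matrix.one_mul]
    rw [this, det_diagonal, norm_prod]
    refine Finset.prod_congr rfl fun i _ => ?_
    rw [Complex.norm_real, Real.norm_of_nonneg (ha _)]

end Determinants

/-! ### Contractions -/

section Contractions

open Matrix
open scoped Matrix.Norms.L2Operator

/-- A matrix is a contraction if its operator norm is at most `1`. -/
def Matrix.IsContraction {n k : Type*} [Fintype n] [Fintype k] [DecidableEq k]
    (V : Matrix n k ℂ) : Prop :=
  ‖V‖ ≤ 1

theorem Matrix.IsContraction.mul {n k l : Type*} [Fintype n] [Fintype k] [Fintype l]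
    [DecidableEq k] [DecidableEq l] {V : Matrix n k ℂ} {W : Matrix k l ℂ}
    (hV : V.IsContraction) (hW : W.IsContraction) : (V * W).IsContraction :=
  (l2_opNorm_mul V W).trans (mul_le_one₀ hV (norm_nonneg _) hW)

theorem Matrix.IsContraction.conjTranspose {n k : Type*} [Fintype n] [Fintype k]
    [DecidableEq n] [DecidableEq k] {V : Matrix n k ℂ} (hV : V.IsContraction) :
    Vᴴ.IsContraction := by
  rwa [IsContraction, l2_opNorm_conjTranspose]

theorem Matrix.isContraction_of_mem_unitaryGroup {n : Type*} [Fintype n] [DecidableEq n]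
    {U : Matrix n n ℂ} (hU : U ∈ unitaryGroup n ℂ) : U.IsContraction :=
  norm_le_one_of_conjTranspose_mul_self (mem_unitaryGroup_iff'.1 hU)

theorem Matrix.isContraction_diagonal {n : Type*} [Fintype n] [DecidableEq n] {d : n → ℂ}
    (hd : ∀ i, ‖d i‖ ≤ 1) : (diagonal d).IsContraction := by
  rw [IsContraction, l2_opNorm_diagonal]
  exact (pi_norm_le_iff_of_nonneg zero_le_one).2 hd

end Contractions

/-! ### Functional calculus and singular values -/

section SingularValues

open Matrix

variable {n : Type*} [Fintype n] [DecidableEq n]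

/-- The functional calculus respects intertwining with a diagonal matrix. -/
theorem Matrix.IsHermitian.cfc_mul_of_mul_eq_mul_diagonal {H : Matrix n n ℂ} (hH : H.IsHermitian)
    {M : Matrix n n ℂ} {a : n → ℝ} (h : H * M = M * diagonal fun i => (a i : ℂ)) (f : ℝ → ℝ) :
    _root_.cfc f H * M = M * diagonal fun i => (f (a i) : ℂ) := by
  have hV : star (hH.eigenvectorUnitary : Matrix n n ℂ) * hH.eigenvectorUnitary = 1 :=
    Unitary.star_mul_self_of_mem hH.eigenvectorUnitary.2
  have hV' : (hH.eigenvectorUnitary : Matrix n n ℂ) * star (hH.eigenvectorUnitary : Matrix n n ℂ)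
      = 1 := Unitary.mul_star_self_of_mem hH.eigenvectorUnitary.2
  have hspec := hH.spectral_theorem
  have hcfc := hH.cfc_eq f
  rw [Matrix.IsHermitian.cfc] at hcfc
  rw [Unitary.conjStarAlgAut_apply] at hspec hcfc
  generalize (hH.eigenvectorUnitary : Matrix n n ℂ) = V at *
  generalize hH.eigenvalues = l at *
  have key : diagonal (RCLike.ofReal ∘ l) * (star V * M) =
      (star V * M) * diagonal fun i => (a i : ℂ) := by
    rw [Matrix.mul_assoc, ← h, hspec]
    simp only [← Matrix.mul_assoc, hV, Matrix.one_mul]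
  have key' : diagonal (RCLike.ofReal ∘ f ∘ l) * (star V * M) =
      (star V * M) * diagonal fun i => (f (a i) : ℂ) := by
    ext i j
    have hij := congrFun (congrFun key i) j
    rw [diagonal_mul, mul_diagonal] at hij ⊢
    -- A nonzero entry forces `l i = a j`, so any `f` takes the same value at both; no continuity is
    -- involved.
    by_cases h0 : (star V * M) i j = 0
    · rw [h0, mul_zero, zero_mul]
    · have hla : l i = a j := by
        rw [mul_comm] at hij
        exact Complex.ofReal_injective (mul_left_cancel₀ h0 hij)
      simp [hla, mul_comm]
  rw [hcfc, Matrix.mul_assoc, Matrix.mul_assoc, key', ← Matrix.mul_assoc, ← Matrix.mul_assoc, hV',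
    Matrix.one_mul]

theorem Matrix.isHermitian_mul_diagonal_ofReal_mul_conjTranspose (U : Matrix n n ℂ) (a : n → ℝ) :
    (U * diagonal (fun i => (a i : ℂ)) * Uᴴ).IsHermitian := by
  refine isHermitian_mul_mul_conjTranspose U (isHermitian_diagonal_of_self_adjoint _ ?_)
  ext i
  simp

theorem Matrix.cfc_unitary_conj_diagonal {U : Matrix n n ℂ} (hU : U ∈ unitaryGroup n ℂ) (a : n → ℝ)
    (f : ℝ → ℝ) : cfc f (U * diagonal (fun i => (a i : ℂ)) * Uᴴ) =
      U * diagonal (fun i => (f (a i) : ℂ)) * Uᴴ := by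
  have hUU : Uᴴ * U = 1 := mem_unitaryGroup_iff'.1 hU
  have hUU' : U * Uᴴ = 1 := mem_unitaryGroup_iff.1 hU
  have h1 := (isHermitian_mul_diagonal_ofReal_mul_conjTranspose U a).cfc_mul_of_mul_eq_mul_diagonal
    (M := U) (a := a) (by rw [Matrix.mul_assoc, hUU, Matrix.mul_one]) f
  rw [← h1, Matrix.mul_assoc (cfc f _), hUU', Matrix.mul_one]

/-- The eigenvalues of the positive semidefinite matrix `X* X` in decreasing order. -/
theorem Matrix.exists_conjTranspose_mul_self_eq_diagonal {m : ℕ} (X : Matrix (Fin m) (Fin m) ℂ) :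
    ∃ U ∈ unitaryGroup (Fin m) ℂ, ∃ a : Fin m → ℝ, Antitone a ∧ (∀ i, 0 ≤ a i) ∧
      Xᴴ * X = U * diagonal (fun i => ((a i ^ 2 : ℝ) : ℂ)) * Uᴴ := by
  have hH : (Xᴴ * X).PosSemidef := posSemidef_conjTranspose_mul_self X
  have hspec := hH.1.spectral_theorem
  rw [Unitary.conjStarAlgAut_apply, star_eq_conjTranspose] at hspec
  have hV : (hH.1.eigenvectorUnitary : Matrix (Fin m) (Fin m) ℂ)ᴴ * hH.1.eigenvectorUnitary = 1 :=
    Unitary.star_mul_self_of_mem hH.1.eigenvectorUnitary.2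
  have hl := hH.eigenvalues_nonneg
  generalize (hH.1.eigenvectorUnitary : Matrix (Fin m) (Fin m) ℂ) = V at *
  generalize hH.1.eigenvalues = l at *
  let σ := Tuple.sort fun i => -l i
  have hσ : Monotone ((fun i => -l i) ∘ σ) := Tuple.monotone_sort _
  refine ⟨V.submatrix id σ, mem_unitaryGroup_iff'.2 ?_, fun i => √(l (σ i)),
    fun i j hij => Real.sqrt_le_sqrt (by simpa using hσ hij), fun i => Real.sqrt_nonneg _, ?_⟩
  · rw [star_eq_conjTranspose, conjTranspose_submatrix, ← submatrix_mul _ _ _ _ _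
      Function.bijective_id, hV, submatrix_one_equiv]
  · rw [hspec]
    have : diagonal (fun i => ((√(l (σ i)) ^ 2 : ℝ) : ℂ)) =
        (diagonal (RCLike.ofReal ∘ l) : Matrix (Fin m) (Fin m) ℂ).submatrix σ σ := by
      rw [submatrix_diagonal_equiv]
      congr 1
      ext i
      simp only [Function.comp_apply, Real.sq_sqrt (hl _)]
      rfl
    rw [this, conjTranspose_submatrix, submatrix_mul_equiv, submatrix_mul_equiv, submatrix_id_id]

theorem absPow_eq_of_conjTranspose_mul_self {m : ℕ} {X U : Matrix (Fin m) (Fin m) ℂ}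
    (hU : U ∈ unitaryGroup (Fin m) ℂ) {a : Fin m → ℝ} (ha : ∀ i, 0 ≤ a i)
    (hX : Xᴴ * X = U * diagonal (fun i => ((a i ^ 2 : ℝ) : ℂ)) * Uᴴ) (r : ℝ) :
    absPow X r = U * diagonal (fun i => ((a i ^ r : ℝ) : ℂ)) * Uᴴ := by
  have hUU : Uᴴ * U = 1 := mem_unitaryGroup_iff'.1 hU
  have hpsd : (U * diagonal (fun i => (a i : ℂ)) * Uᴴ).PosSemidef :=
    (PosSemidef.diagonal fun i => by simpa using ha i).mul_mul_conjTranspose_same U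
  have habs : CFC.abs X = U * diagonal (fun i => (a i : ℂ)) * Uᴴ := by
    refine CFC.sqrt_unique ?_ hpsd.nonneg
    rw [star_eq_conjTranspose, hX]
    calc _ = U * diagonal (fun i => (a i : ℂ)) * (Uᴴ * U) * diagonal (fun i => (a i : ℂ)) * Uᴴ := by
          simp only [Matrix.mul_assoc]
      _ = _ := by
          rw [hUU, Matrix.mul_one, Matrix.mul_assoc U, diagonal_mul_diagonal]
          simp [sq]
  rw [absPow, CFC.rpow, habs, cfc_nnreal_eq_real _ _ hpsd.nonneg, cfc_unitary_conj_diagonal hU]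
  simp [ha]

/-- The symmetric gauge function of a norm on matrices: its restriction to real diagonal
matrices. -/
noncomputable def Seminorm.diagonalGauge {m : ℕ} (N : Seminorm ℂ (Matrix (Fin m) (Fin m) ℂ)) :
    Seminorm ℝ (Fin m → ℝ) :=
  Seminorm.of (fun x => N (diagonal fun i => (x i : ℂ)))
    (fun x y => by
      have : (diagonal fun i => ((x + y) i : ℂ)) =
          diagonal (fun i => (x i : ℂ)) + diagonal fun i => (y i : ℂ) := by
        rw [diagonal_add]
        congr 1
        ext i
        simp
      rw [this]
      exact map_add_le_add N _ _)
    (fun c x => by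
      have : (diagonal fun i => ((c • x) i : ℂ)) = (c : ℂ) • diagonal fun i => (x i : ℂ) := by
        rw [← diagonal_smul]
        congr 1
        ext i
        simp
      rw [this, map_smul_eq_mul, Complex.norm_real])

end SingularValues

/-! ### Unitarily invariant norms as symmetric gauges -/

section Gauge

open Matrix

variable {m : ℕ} {N : Seminorm ℂ (Matrix (Fin m) (Fin m) ℂ)}

theorem Seminorm.diagonalGauge_apply (x : Fin m → ℝ) :
    N.diagonalGauge x = N (diagonal fun i => (x i : ℂ)) := rfl

/-- Conjugation by a permutation matrix, which is unitary, permutes the diagonal. -/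
theorem IsUnitarilyInvariantNorm.diagonalGauge_comp_perm (hN : IsUnitarilyInvariantNorm N)
    (σ : Equiv.Perm (Fin m)) (x : Fin m → ℝ) : N.diagonalGauge (x ∘ σ) = N.diagonalGauge x := by
  let W : Matrix (Fin m) (Fin m) ℂ := (1 : Matrix (Fin m) (Fin m) ℂ).submatrix σ id
  let W' : Matrix (Fin m) (Fin m) ℂ := (1 : Matrix (Fin m) (Fin m) ℂ).submatrix id σ
  have hstar : star W = W' := by
    rw [star_eq_conjTranspose, conjTranspose_submatrix, conjTranspose_one]
  have hstar' : star W' = W := by rw [← hstar, star_star]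
  have hW : W * W' = 1 := by
    rw [← submatrix_mul _ _ _ _ _ Function.bijective_id, Matrix.one_mul, submatrix_one_equiv]
  have hdiag : (diagonal fun i => ((x ∘ σ) i : ℂ)) = W * diagonal (fun i => (x i : ℂ)) * W' := by
    have h1 : diagonal (fun i => (x i : ℂ)) = (diagonal fun i => (x i : ℂ)).submatrix id id := rfl
    rw [h1, ← submatrix_mul _ _ _ _ _ Function.bijective_id, ← submatrix_mul _ _ _ _ _
      Function.bijective_id, Matrix.one_mul, Matrix.mul_one, submatrix_diagonal_equiv]
    rfl
  rw [Seminorm.diagonalGauge_apply, hdiag, hN.unitarily_invariant W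
    (mem_unitaryGroup_iff.2 (by rw [hstar, hW])) W'
    (mem_unitaryGroup_iff'.2 (by rw [hstar', hW])), Seminorm.diagonalGauge_apply]

theorem IsUnitarilyInvariantNorm.diagonalGauge_mul_sign (hN : IsUnitarilyInvariantNorm N)
    (ε : Fin m → ℝ) (hε : ∀ i, |ε i| = 1) (x : Fin m → ℝ) :
    N.diagonalGauge (ε * x) = N.diagonalGauge x := by
  have hdiag : (diagonal fun i => ((ε * x) i : ℂ)) =
      diagonal (fun i => (ε i : ℂ)) * diagonal (fun i => (x i : ℂ)) * 1 := by
    rw [Matrix.mul_one, diagonal_mul_diagonal]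
    simp
  rw [Seminorm.diagonalGauge_apply, hdiag, hN.unitarily_invariant _ ?_ 1 (one_mem _),
    Seminorm.diagonalGauge_apply]
  rw [mem_unitaryGroup_iff, star_eq_conjTranspose, diagonal_conjTranspose, diagonal_mul_diagonal,
    ← diagonal_one]
  congr 1
  ext i
  have : ε i * ε i = 1 := by rw [← abs_mul_abs_self, hε, one_mul]
  simpa using congrArg (fun t : ℝ => (t : ℂ)) this

theorem IsUnitarilyInvariantNorm.map_absPow_eq (hN : IsUnitarilyInvariantNorm N)
    {X U : Matrix (Fin m) (Fin m) ℂ} (hU : U ∈ unitaryGroup (Fin m) ℂ) {a : Fin m → ℝ}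
    (ha : ∀ i, 0 ≤ a i) (hX : Xᴴ * X = U * diagonal (fun i => ((a i ^ 2 : ℝ) : ℂ)) * Uᴴ) (r : ℝ) :
    N (absPow X r) = N.diagonalGauge fun i => a i ^ r := by
  rw [absPow_eq_of_conjTranspose_mul_self hU ha hX,
    hN.unitarily_invariant U hU Uᴴ (Unitary.star_mem hU), Seminorm.diagonalGauge_apply]

/-- If all minors of `X` in contractive frames interpolate between those of `Y` and `Z`, then so
do the values of `‖|·| ^ r‖`. -/
theorem IsUnitarilyInvariantNorm.map_absPow_le_of_norm_det_le (hN : IsUnitarilyInvariantNorm N)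
    {X Y Z : Matrix (Fin m) (Fin m) ℂ} {r θ : ℝ} (hr : 0 < r) (h0 : 0 ≤ θ) (h1 : θ ≤ 1)
    (H : ∀ (k : ℕ) (β γ : ℝ),
      (∀ P Q : Matrix (Fin m) (Fin k) ℂ, P.IsContraction → Q.IsContraction →
        ‖(Qᴴ * Y * P).det‖ ≤ β) →
      (∀ P Q : Matrix (Fin m) (Fin k) ℂ, P.IsContraction → Q.IsContraction →
        ‖(Qᴴ * Z * P).det‖ ≤ γ) →
      ∀ P Q : Matrix (Fin m) (Fin k) ℂ, P.IsContraction → Q.IsContraction →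
        ‖(Qᴴ * X * P).det‖ ≤ β ^ θ * γ ^ (1 - θ)) :
    N (absPow X r) ≤ N (absPow Y r) ^ θ * N (absPow Z r) ^ (1 - θ) := by
  obtain ⟨U, hU, a, haa, ha, hX⟩ := exists_conjTranspose_mul_self_eq_diagonal X
  obtain ⟨V, hV, b, hba, hb, hY⟩ := exists_conjTranspose_mul_self_eq_diagonal Y
  obtain ⟨W, hW, c, hca, hc, hZ⟩ := exists_conjTranspose_mul_self_eq_diagonal Z
  rw [hN.map_absPow_eq hU ha hX, hN.map_absPow_eq hV hb hY, hN.map_absPow_eq hW hc hZ]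
  refine symmetric_gauge_le_of_prod_le N.diagonalGauge hN.diagonalGauge_comp_perm
    hN.diagonalGauge_mul_sign (fun i j hij => Real.rpow_le_rpow (ha _) (haa hij) hr.le)
    (fun i => Real.rpow_nonneg (ha i) r) (fun i => Real.rpow_nonneg (hb i) r)
    (fun i => Real.rpow_nonneg (hc i) r) h0 h1 fun k hk => ?_
  have hbk : 0 ≤ ∏ i : Fin k, b (Fin.castLE hk i) := Finset.prod_nonneg fun i _ => hb _
  have hck : 0 ≤ ∏ i : Fin k, c (Fin.castLE hk i) := Finset.prod_nonneg fun i _ => hc _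
  have hcomm {x : ℝ} (hx : 0 ≤ x) (s : ℝ) : (x ^ r) ^ s = (x ^ s) ^ r := by
    rw [← Real.rpow_mul hx, ← Real.rpow_mul hx, mul_comm]
  have hrhs : ∏ i : Fin k, ((b (Fin.castLE hk i) ^ r) ^ θ * (c (Fin.castLE hk i) ^ r) ^ (1 - θ)) =
      ((∏ i : Fin k, b (Fin.castLE hk i)) ^ θ *
        (∏ i : Fin k, c (Fin.castLE hk i)) ^ (1 - θ)) ^ r := by
    rw [Finset.prod_mul_distrib, Real.finsetProd_rpow _ _ fun i _ => Real.rpow_nonneg (hb _) _,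
      Real.finsetProd_rpow _ _ fun i _ => hb _,
      Real.finsetProd_rpow _ _ fun i _ => Real.rpow_nonneg (hc _) _,
      Real.finsetProd_rpow _ _ fun i _ => hc _,
      Real.mul_rpow (Real.rpow_nonneg hbk _) (Real.rpow_nonneg hck _), hcomm hbk, hcomm hck]
  rw [hrhs, Real.finsetProd_rpow _ _ fun i _ => ha _]
  refine Real.rpow_le_rpow (Finset.prod_nonneg fun i _ => ha _) ?_ hr.le
  -- Optimal frames exist only for a nonzero product; the zero case is trivial.
  by_cases hzero : ∏ i : Fin k, a (Fin.castLE hk i) = 0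
  · rw [hzero]
    exact mul_nonneg (Real.rpow_nonneg hbk _) (Real.rpow_nonneg hck _)
  · obtain ⟨P, Q, hP, hQ, hdet⟩ := exists_norm_det_conjTranspose_mul_mul_eq hk hU ha hX hzero
    rw [← hdet]
    exact H k _ _ (fun P Q hP hQ => norm_det_conjTranspose_mul_mul_le hk hV hb hba hY hP hQ)
      (fun P Q hP hQ => norm_det_conjTranspose_mul_mul_le hk hW hc hca hZ hP hQ) P Q hP hQ

end Gauge

/-! ### Complex powers vanishing on the kernel -/

section ComplexPowers

open Matrix

/-- The complex power `x ^ z` of a real number, with the value `0` at `x = 0`. -/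
noncomputable def suppCPow (z : ℂ) (x : ℝ) : ℂ := if x = 0 then 0 else (x : ℂ) ^ z

/-- The value `0` at `x = 0` makes this hold for all exponents, including `z - 1` and `1`, used at
`re z = 1`. -/
theorem suppCPow_add (z w : ℂ) (x : ℝ) : suppCPow (z + w) x = suppCPow z x * suppCPow w x := by
  by_cases h : x = 0
  · simp [suppCPow, h]
  · simp [suppCPow, h, Complex.cpow_add]

theorem suppCPow_one (x : ℝ) : suppCPow 1 x = x := by
  by_cases h : x = 0 <;> simp [suppCPow, h]

theorem suppCPow_ofReal {x : ℝ} (hx : 0 ≤ x) (t : ℝ) :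
    suppCPow t x = (ZeroPowConvention.support.scalarPow x t : ℂ) := by
  by_cases h : x = 0
  · simp [suppCPow, ZeroPowConvention.scalarPow, h]
  · simp [suppCPow, ZeroPowConvention.scalarPow, h, Complex.ofReal_cpow hx]

theorem norm_suppCPow_le_one {x : ℝ} (hx : 0 ≤ x) {z : ℂ} (hz : z.re = 0) :
    ‖suppCPow z x‖ ≤ 1 := by
  rcases hx.eq_or_lt with rfl | h
  · simp [suppCPow]
  · simp [suppCPow, h.ne', Complex.norm_cpow_eq_rpow_re_of_pos h, hz]

theorem norm_suppCPow_le_max {x : ℝ} (hx : 0 ≤ x) {z : ℂ} (hz0 : 0 ≤ z.re) (hz1 : z.re ≤ 1) :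
    ‖suppCPow z x‖ ≤ max 1 x := by
  rcases hx.eq_or_lt with rfl | h
  · simp [suppCPow]
  · simp only [suppCPow, h.ne', if_false, Complex.norm_cpow_eq_rpow_re_of_pos h]
    rcases le_total x 1 with hx1 | hx1
    · exact (Real.rpow_le_one hx hx1 hz0).trans (le_max_left _ _)
    · refine le_trans ?_ (le_max_right _ _)
      simpa using Real.rpow_le_rpow_of_exponent_le hx1 hz1

theorem differentiable_suppCPow (x : ℝ) : Differentiable ℂ fun z => suppCPow z x := by
  by_cases h : x = 0
  · simp [suppCPow, h]
  · simp only [suppCPow, h, if_false]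
    exact fun z => (differentiableAt_id).const_cpow (Or.inl (by exact_mod_cast h))

variable {n : Type*} [Fintype n] [DecidableEq n] {A : Matrix n n ℂ}

/-- The functional calculus of a Hermitian matrix for complex-valued functions. -/
noncomputable def Matrix.IsHermitian.complexCfc (hA : A.IsHermitian) (f : ℝ → ℂ) : Matrix n n ℂ :=
  (hA.eigenvectorUnitary : Matrix n n ℂ) * diagonal (fun i => f (hA.eigenvalues i)) *
    (hA.eigenvectorUnitary : Matrix n n ℂ)ᴴ

theorem Matrix.IsHermitian.complexCfc_ofReal (hA : A.IsHermitian) (f : ℝ → ℝ) :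
    hA.complexCfc (fun x => (f x : ℂ)) = _root_.cfc f A := by
  rw [hA.cfc_eq, Matrix.IsHermitian.cfc, Unitary.conjStarAlgAut_apply]
  rfl

theorem Matrix.IsHermitian.complexCfc_congr (hA : A.IsHermitian) {f g : ℝ → ℂ}
    (h : ∀ i, f (hA.eigenvalues i) = g (hA.eigenvalues i)) : hA.complexCfc f = hA.complexCfc g := by
  simp only [complexCfc, h]

theorem Matrix.IsHermitian.complexCfc_mul (hA : A.IsHermitian) (f g : ℝ → ℂ) :
    hA.complexCfc (fun x => f x * g x) = hA.complexCfc f * hA.complexCfc g := by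
  have hV : (hA.eigenvectorUnitary : Matrix n n ℂ)ᴴ * hA.eigenvectorUnitary = 1 :=
    Unitary.star_mul_self_of_mem hA.eigenvectorUnitary.2
  simp only [complexCfc]
  generalize (hA.eigenvectorUnitary : Matrix n n ℂ) = V at *
  generalize hA.eigenvalues = l at *
  symm
  calc _ = V * diagonal (fun i => f (l i)) * (Vᴴ * V) * diagonal (fun i => g (l i)) * Vᴴ := by
        simp only [Matrix.mul_assoc]
    _ = _ := by rw [hV, Matrix.mul_one, Matrix.mul_assoc V, diagonal_mul_diagonal]

/-- Splitting `f` into real and imaginary parts reduces this to the real functional calculus. -/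
theorem Matrix.IsHermitian.commute_complexCfc (hA : A.IsHermitian) {B : Matrix n n ℂ}
    (h : Commute A B) (f : ℝ → ℂ) : Commute (hA.complexCfc f) B := by
  have hf : hA.complexCfc f = _root_.cfc (fun x => (f x).re) A +
      Complex.I • _root_.cfc (fun x => (f x).im) A := by
    rw [← hA.complexCfc_ofReal, ← hA.complexCfc_ofReal]
    simp only [complexCfc]
    rw [← Matrix.smul_mul, ← Matrix.mul_smul, ← Matrix.add_mul, ← Matrix.mul_add, ← diagonal_smul,
      diagonal_add]
    congr 3
    ext i
    simp [mul_comm Complex.I, Complex.re_add_im]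
  rw [hf]
  exact (h.cfc_real _).add_left ((h.cfc_real _).smul_left _)

theorem Matrix.IsHermitian.isContraction_complexCfc (hA : A.IsHermitian) {f : ℝ → ℂ}
    (hf : ∀ i, ‖f (hA.eigenvalues i)‖ ≤ 1) : (hA.complexCfc f).IsContraction :=
  have hU := isContraction_of_mem_unitaryGroup hA.eigenvectorUnitary.2
  (hU.mul (isContraction_diagonal hf)).mul hU.conjTranspose

/-- The complex power of a Hermitian matrix, vanishing on its kernel. -/
noncomputable def Matrix.IsHermitian.suppCPow (hA : A.IsHermitian) (z : ℂ) : Matrix n n ℂ :=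
  hA.complexCfc (_root_.suppCPow z)

theorem Matrix.IsHermitian.suppCPow_add (hA : A.IsHermitian) (z w : ℂ) :
    hA.suppCPow (z + w) = hA.suppCPow z * hA.suppCPow w := by
  rw [suppCPow, suppCPow, suppCPow, ← hA.complexCfc_mul]
  exact hA.complexCfc_congr fun i => _root_.suppCPow_add _ _ _

theorem Matrix.IsHermitian.suppCPow_one (hA : A.IsHermitian) : hA.suppCPow 1 = A := by
  have h := hA.complexCfc_ofReal id
  rw [cfc_id ℝ A hA.isSelfAdjoint] at h
  conv_rhs => rw [← h]
  exact hA.complexCfc_congr fun i => _root_.suppCPow_one _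

theorem Matrix.PosSemidef.suppCPow_ofReal {m : ℕ} {A : Matrix (Fin m) (Fin m) ℂ}
    (hA : A.PosSemidef) (t : ℝ) :
    hA.1.suppCPow t = ZeroPowConvention.support.matrixPow A t := by
  rw [ZeroPowConvention.matrixPow, ← hA.1.complexCfc_ofReal]
  exact hA.1.complexCfc_congr fun i => _root_.suppCPow_ofReal (hA.eigenvalues_nonneg i) t

theorem Matrix.PosSemidef.isContraction_suppCPow (hA : A.PosSemidef) {z : ℂ} (hz : z.re = 0) :
    (hA.1.suppCPow z).IsContraction :=
  hA.1.isContraction_complexCfc fun i => norm_suppCPow_le_one (hA.eigenvalues_nonneg i) hz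

theorem Matrix.IsHermitian.commute_suppCPow (hA : A.IsHermitian) {B : Matrix n n ℂ}
    (h : Commute A B) (z : ℂ) : Commute (hA.suppCPow z) B :=
  hA.commute_complexCfc h _

end ComplexPowers

/-! ### Holomorphy of entries and minors -/

section DifferentiableEntries

open Matrix

theorem Matrix.differentiable_mul_entry {l n k : Type*} [Fintype n] {F : ℂ → Matrix l n ℂ}
    {G : ℂ → Matrix n k ℂ} (hF : ∀ i j, Differentiable ℂ fun z => F z i j)
    (hG : ∀ i j, Differentiable ℂ fun z => G z i j) (i : l) (j : k) :
    Differentiable ℂ fun z => (F z * G z) i j := by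
  simp only [mul_apply]
  exact Differentiable.fun_sum fun x _ => (hF i x).fun_mul (hG x j)

theorem Matrix.differentiable_det {n : Type*} [Fintype n] [DecidableEq n] {F : ℂ → Matrix n n ℂ}
    (hF : ∀ i j, Differentiable ℂ fun z => F z i j) : Differentiable ℂ fun z => (F z).det := by
  simp only [det_apply]
  exact Differentiable.fun_sum fun σ _ =>
    (Differentiable.fun_finsetProd fun i _ => hF _ _).const_smul _

theorem Matrix.IsHermitian.differentiable_suppCPow_entry {n : Type*} [Fintype n] [DecidableEq n]
    {A : Matrix n n ℂ} (hA : A.IsHermitian) {g : ℂ → ℂ} (hg : Differentiable ℂ g) (i j : n) :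
    Differentiable ℂ fun z => hA.suppCPow (g z) i j := by
  have hdiag (i j : n) : Differentiable ℂ fun z =>
      (diagonal fun i => _root_.suppCPow (g z) (hA.eigenvalues i)) i j := by
    by_cases h : i = j
    · subst h
      simp only [diagonal_apply_eq]
      exact (differentiable_suppCPow _).comp hg
    · simp [h]
  simp only [suppCPow, complexCfc]
  generalize (hA.eigenvectorUnitary : Matrix n n ℂ) = V
  exact differentiable_mul_entry (G := fun _ => Vᴴ)
    (differentiable_mul_entry (F := fun _ => V) (fun _ _ => differentiable_const _) hdiag)
    (fun _ _ => differentiable_const _) i j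

end DifferentiableEntries

/-! ### Interpolation of minors by the three lines theorem -/

section ThreeLines

open Matrix

variable {m : ℕ} {A₁ A₂ B₁ B₂ : Matrix (Fin m) (Fin m) ℂ}

/-- The minors of the product of complex powers of four positive semidefinite matrices are bounded
on the strip `0 ≤ re z ≤ 1`. -/
theorem Matrix.bddAbove_norm_det_suppCPow {k : ℕ} (hA₁ : A₁.PosSemidef) (hA₂ : A₂.PosSemidef)
    (hB₁ : B₁.PosSemidef) (hB₂ : B₂.PosSemidef) (P Q : Matrix (Fin m) (Fin k) ℂ) :
    BddAbove ((norm ∘ fun z : ℂ => (Qᴴ * (hA₁.1.suppCPow z * hA₂.1.suppCPow (1 - z) *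
      (hB₁.1.suppCPow z * hB₂.1.suppCPow (1 - z))) * P).det) ''
        Complex.HadamardThreeLines.verticalClosedStrip 0 1) := by
  let φ (C : Matrix (Fin m) (Fin m) ℂ) (d : Fin m → ℂ) : Matrix (Fin m) (Fin m) ℂ :=
    C * diagonal d * Cᴴ
  -- On the strip the powers of the eigenvalues stay in a compact polydisc, and the minor is a
  -- continuous function of them.
  let ball (l : Fin m → ℝ) : Set (Fin m → ℂ) :=
    Set.univ.pi fun i => Metric.closedBall 0 (max 1 (l i))
  have hball (l : Fin m → ℝ) : IsCompact (ball l) :=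
    isCompact_univ_pi fun i => isCompact_closedBall _ _
  have hmem {A : Matrix (Fin m) (Fin m) ℂ} (hA : A.PosSemidef) {z : ℂ} (h0 : 0 ≤ z.re)
      (h1 : z.re ≤ 1) : (fun i => suppCPow z (hA.1.eigenvalues i)) ∈ ball hA.1.eigenvalues :=
    fun i _ => mem_closedBall_zero_iff.2 (norm_suppCPow_le_max (hA.eigenvalues_nonneg i) h0 h1)
  let Φ (p : (Fin m → ℂ) × (Fin m → ℂ) × (Fin m → ℂ) × (Fin m → ℂ)) : ℝ :=
    ‖(Qᴴ * (φ hA₁.1.eigenvectorUnitary p.1 * φ hA₂.1.eigenvectorUnitary p.2.1 *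
      (φ hB₁.1.eigenvectorUnitary p.2.2.1 * φ hB₂.1.eigenvectorUnitary p.2.2.2)) * P).det‖
  have hΦ : Continuous Φ := by fun_prop
  have hK := (hball hA₁.1.eigenvalues).prod ((hball hA₂.1.eigenvalues).prod
    ((hball hB₁.1.eigenvalues).prod (hball hB₂.1.eigenvalues)))
  refine (hK.bddAbove_image hΦ.continuousOn).mono ?_
  rintro _ ⟨z, hz, rfl⟩
  have h0 : 0 ≤ z.re := hz.1
  have h1 : z.re ≤ 1 := hz.2
  have h0' : 0 ≤ (1 - z).re := by simpa using h1
  have h1' : (1 - z).re ≤ 1 := by simpa using h0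
  exact ⟨⟨_, _, _, _⟩, ⟨hmem hA₁ h0 h1, hmem hA₂ h0' h1', hmem hB₁ h0 h1, hmem hB₂ h0' h1'⟩, rfl⟩

/-- Pull `A₁` out of `A₁^z` and move it past `A₂^(1-z)`, to meet the `B₁` pulled out of `B₁^z`. On
`re z = 1` the outer factors have imaginary exponents and are contractions. -/
theorem Matrix.suppCPow_mul_eq_left_mul_right_of_commute_left (hA₁ : A₁.PosSemidef)
    (hA₂ : A₂.PosSemidef) (hB₁ : B₁.PosSemidef) (hB₂ : B₂.PosSemidef) (hA : Commute A₁ A₂) (z : ℂ) :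
    hA₁.1.suppCPow z * hA₂.1.suppCPow (1 - z) * (hB₁.1.suppCPow z * hB₂.1.suppCPow (1 - z)) =
      hA₁.1.suppCPow (z - 1) * hA₂.1.suppCPow (1 - z) * (A₁ * B₁) *
        (hB₁.1.suppCPow (z - 1) * hB₂.1.suppCPow (1 - z)) := by
  have e1 := hA₁.1.suppCPow_add (z - 1) 1
  have e2 := hB₁.1.suppCPow_add 1 (z - 1)
  rw [sub_add_cancel, hA₁.1.suppCPow_one] at e1
  rw [add_sub_cancel, hB₁.1.suppCPow_one] at e2
  have e3 : A₁ * hA₂.1.suppCPow (1 - z) = hA₂.1.suppCPow (1 - z) * A₁ :=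
    (hA₂.1.commute_suppCPow hA.symm (1 - z)).symm
  calc _ = hA₁.1.suppCPow (z - 1) * (A₁ * hA₂.1.suppCPow (1 - z)) * (B₁ *
        hB₁.1.suppCPow (z - 1)) * hB₂.1.suppCPow (1 - z) := by
          simp only [e1, e2, Matrix.mul_assoc]
    _ = _ := by rw [e3]; simp only [Matrix.mul_assoc]

/-- The counterpart for `re z = 0`: here `B₂` is moved past `B₁^z` to meet `A₂`. -/
theorem Matrix.suppCPow_mul_eq_left_mul_right_of_commute_right (hA₁ : A₁.PosSemidef)
    (hA₂ : A₂.PosSemidef) (hB₁ : B₁.PosSemidef) (hB₂ : B₂.PosSemidef) (hB : Commute B₁ B₂) (z : ℂ) :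
    hA₁.1.suppCPow z * hA₂.1.suppCPow (1 - z) * (hB₁.1.suppCPow z * hB₂.1.suppCPow (1 - z)) =
      hA₁.1.suppCPow z * hA₂.1.suppCPow (-z) * (A₂ * B₂) *
        (hB₁.1.suppCPow z * hB₂.1.suppCPow (-z)) := by
  have e1 : hA₂.1.suppCPow (1 - z) = hA₂.1.suppCPow (-z) * A₂ := by
    rw [sub_eq_neg_add, hA₂.1.suppCPow_add, hA₂.1.suppCPow_one]
  have e2 : hB₂.1.suppCPow (1 - z) = B₂ * hB₂.1.suppCPow (-z) := by
    rw [sub_eq_add_neg, hB₂.1.suppCPow_add, hB₂.1.suppCPow_one]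
  have e3 : hB₁.1.suppCPow z * B₂ = B₂ * hB₁.1.suppCPow z := hB₁.1.commute_suppCPow hB z
  calc _ = hA₁.1.suppCPow z * hA₂.1.suppCPow (-z) * A₂ * (hB₁.1.suppCPow z * B₂) *
        hB₂.1.suppCPow (-z) := by simp only [e1, e2, Matrix.mul_assoc]
    _ = _ := by rw [e3]; simp only [Matrix.mul_assoc]

/-- Complex interpolation for the minors of `(A₁ ^ θ A₂ ^ (1 - θ)) (B₁ ^ θ B₂ ^ (1 - θ))`. -/
theorem Matrix.norm_det_matrixPow_le_interpolation (hA₁ : A₁.PosSemidef) (hA₂ : A₂.PosSemidef)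
    (hB₁ : B₁.PosSemidef) (hB₂ : B₂.PosSemidef) (hA : Commute A₁ A₂) (hB : Commute B₁ B₂)
    {θ : ℝ} (hθ0 : 0 ≤ θ) (hθ1 : θ ≤ 1) {k : ℕ} {β γ : ℝ}
    (hβ : ∀ P Q : Matrix (Fin m) (Fin k) ℂ, P.IsContraction → Q.IsContraction →
      ‖(Qᴴ * (A₁ * B₁) * P).det‖ ≤ β)
    (hγ : ∀ P Q : Matrix (Fin m) (Fin k) ℂ, P.IsContraction → Q.IsContraction →
      ‖(Qᴴ * (A₂ * B₂) * P).det‖ ≤ γ)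
    {P Q : Matrix (Fin m) (Fin k) ℂ} (hP : P.IsContraction) (hQ : Q.IsContraction) :
    ‖(Qᴴ * (ZeroPowConvention.support.matrixPow A₁ θ *
      ZeroPowConvention.support.matrixPow A₂ (1 - θ) *
        (ZeroPowConvention.support.matrixPow B₁ θ *
          ZeroPowConvention.support.matrixPow B₂ (1 - θ))) * P).det‖ ≤ β ^ θ * γ ^ (1 - θ) := by
  -- Contractive factors around `C` are absorbed into the frames; this is why frames range over all
  -- contractions, not only isometries.
  have hcontr {C D : Matrix (Fin m) (Fin m) ℂ} {δ : ℝ}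
      (hδ : ∀ P Q : Matrix (Fin m) (Fin k) ℂ, P.IsContraction → Q.IsContraction →
        ‖(Qᴴ * C * P).det‖ ≤ δ) {G G' : Matrix (Fin m) (Fin m) ℂ} (hG : G.IsContraction)
      (hG' : G'.IsContraction) (hD : D = G * C * G') : ‖(Qᴴ * D * P).det‖ ≤ δ := by
    have := hδ (G' * P) (Gᴴ * Q) (hG'.mul hP) (hG.conjTranspose.mul hQ)
    rw [conjTranspose_mul, conjTranspose_conjTranspose] at this
    rw [hD]
    simpa only [Matrix.mul_assoc] using this
  let F (z : ℂ) : Matrix (Fin m) (Fin m) ℂ := hA₁.1.suppCPow z * hA₂.1.suppCPow (1 - z) *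
    (hB₁.1.suppCPow z * hB₂.1.suppCPow (1 - z))
  have hF (i j : Fin m) : Differentiable ℂ fun z => F z i j :=
    differentiable_mul_entry
      (differentiable_mul_entry (hA₁.1.differentiable_suppCPow_entry differentiable_id)
        (hA₂.1.differentiable_suppCPow_entry (differentiable_id.const_sub 1)))
      (differentiable_mul_entry (hB₁.1.differentiable_suppCPow_entry differentiable_id)
        (hB₂.1.differentiable_suppCPow_entry (differentiable_id.const_sub 1))) i j
  have hdiff : Differentiable ℂ fun z => (Qᴴ * F z * P).det :=
    differentiable_det <| differentiable_mul_entry (G := fun _ => P)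
      (differentiable_mul_entry (F := fun _ => Qᴴ) (fun _ _ => differentiable_const _) hF)
      fun _ _ => differentiable_const _
  have hmid : (θ : ℂ) ∈ Complex.HadamardThreeLines.verticalClosedStrip 0 1 :=
    ⟨by simpa using hθ0, by simpa using hθ1⟩
  have key := Complex.HadamardThreeLines.norm_le_interp_of_mem_verticalClosedStrip₀₁'
    (fun z => (Qᴴ * F z * P).det) (a := γ) (b := β) hmid hdiff.diffContOnCl
    (bddAbove_norm_det_suppCPow hA₁ hA₂ hB₁ hB₂ P Q) ?_ ?_
  · have hF' : F θ = ZeroPowConvention.support.matrixPow A₁ θ *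
        ZeroPowConvention.support.matrixPow A₂ (1 - θ) *
        (ZeroPowConvention.support.matrixPow B₁ θ *
          ZeroPowConvention.support.matrixPow B₂ (1 - θ)) := by
      simp only [F, ← hA₁.suppCPow_ofReal, ← hA₂.suppCPow_ofReal, ← hB₁.suppCPow_ofReal,
        ← hB₂.suppCPow_ofReal, Complex.ofReal_sub, Complex.ofReal_one]
    rw [← hF', mul_comm]
    simpa using key
  · intro z hz
    have hz0 : z.re = 0 := hz
    have hz0' : (-z).re = 0 := by simp [hz0]
    exact hcontr hγ ((hA₁.isContraction_suppCPow hz0).mul (hA₂.isContraction_suppCPow hz0'))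
      ((hB₁.isContraction_suppCPow hz0).mul (hB₂.isContraction_suppCPow hz0'))
      (suppCPow_mul_eq_left_mul_right_of_commute_right hA₁ hA₂ hB₁ hB₂ hB z)
  · intro z hz
    have hz1 : z.re = 1 := hz
    have hz0 : (z - 1).re = 0 := by simp [hz1]
    have hz0' : (1 - z).re = 0 := by simp [hz1]
    exact hcontr hβ ((hA₁.isContraction_suppCPow hz0).mul (hA₂.isContraction_suppCPow hz0'))
      ((hB₁.isContraction_suppCPow hz0).mul (hB₂.isContraction_suppCPow hz0'))
      (suppCPow_mul_eq_left_mul_right_of_commute_left hA₁ hA₂ hB₁ hB₂ hA z)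

end ThreeLines

/-! ### The two conventions for zeroth powers -/

section ZeroPow

open Matrix

namespace ZeroPowConvention

variable {m : ℕ}

theorem scalarPow_of_pos (c : ZeroPowConvention) (x : ℝ) {t : ℝ} (ht : 0 < t) :
    c.scalarPow x t = x ^ t := by
  cases c
  · rfl
  · by_cases h : x = 0
    · simp [scalarPow, h, Real.zero_rpow ht.ne']
    · simp [scalarPow, h]

theorem scalarPow_nonneg (c : ZeroPowConvention) {x : ℝ} (hx : 0 ≤ x) (t : ℝ) :
    0 ≤ c.scalarPow x t := by
  cases c
  · exact Real.rpow_nonneg hx t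
  · by_cases h : x = 0
    · simp [scalarPow, h]
    · simpa [scalarPow, h] using Real.rpow_nonneg hx t

/-- Since `a, b > 0`, the convention matters only for the inner powers and the result, and at `x =
0` both sides agree in either convention. -/
theorem scalarPow_scalarPow_mul (c : ZeroPowConvention) {x : ℝ} (hx : 0 ≤ x) {s t a b : ℝ}
    (hs : 0 ≤ s) (ht : 0 ≤ t) (ha : 0 < a) (hb : 0 < b) :
    c.scalarPow (c.scalarPow x s) a * c.scalarPow (c.scalarPow x t) b =
      c.scalarPow x (a * s + b * t) := by
  rw [scalarPow_of_pos _ _ ha, scalarPow_of_pos _ _ hb]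
  have h : (x ^ s) ^ a * (x ^ t) ^ b = x ^ (a * s + b * t) := by
    rw [← Real.rpow_mul hx, ← Real.rpow_mul hx, mul_comm s, mul_comm t,
      Real.rpow_add_of_nonneg hx (mul_nonneg ha.le hs) (mul_nonneg hb.le ht)]
  cases c
  · exact h
  · by_cases h0 : x = 0
    · simp [scalarPow, h0, Real.zero_rpow ha.ne']
    · simpa [scalarPow, h0] using h

theorem matrixPow_of_pos (c : ZeroPowConvention) (A : Matrix (Fin m) (Fin m) ℂ) {t : ℝ}
    (ht : 0 < t) : c.matrixPow A t = support.matrixPow A t := by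
  simp only [matrixPow, scalarPow_of_pos _ _ ht]

theorem identity_matrixPow_zero {A : Matrix (Fin m) (Fin m) ℂ} (hA : A.PosSemidef) :
    identity.matrixPow A 0 = 1 := by
  simp only [matrixPow, scalarPow, Real.rpow_zero]
  exact cfc_const_one ℝ A hA.1.isSelfAdjoint

theorem identity_matrixPow_one {A : Matrix (Fin m) (Fin m) ℂ} (hA : A.PosSemidef) :
    identity.matrixPow A 1 = A := by
  simp only [matrixPow, scalarPow, Real.rpow_one]
  exact cfc_id' ℝ A hA.1.isSelfAdjoint

theorem posSemidef_matrixPow (c : ZeroPowConvention) {A : Matrix (Fin m) (Fin m) ℂ}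
    (hA : A.PosSemidef) (t : ℝ) : (c.matrixPow A t).PosSemidef :=
  nonneg_iff_posSemidef.1 <|
    cfc_nonneg fun _ hx => c.scalarPow_nonneg (spectrum_nonneg_of_nonneg hA.nonneg hx) t

theorem matrixPow_matrixPow_mul (c : ZeroPowConvention) {A : Matrix (Fin m) (Fin m) ℂ}
    (hA : A.PosSemidef) {s t a b : ℝ} (hs : 0 ≤ s) (ht : 0 ≤ t) (ha : 0 < a) (hb : 0 < b) :
    c.matrixPow (c.matrixPow A s) a * c.matrixPow (c.matrixPow A t) b =
      c.matrixPow A (a * s + b * t) := by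
  have hcont (f : ℝ → ℝ) : ContinuousOn f (spectrum ℝ A) :=
    finite_real_spectrum.continuousOn f
  have hcont' (f g : ℝ → ℝ) : ContinuousOn f (g '' spectrum ℝ A) :=
    (finite_real_spectrum.image g).continuousOn f
  have hsa : IsSelfAdjoint A := hA.1.isSelfAdjoint
  simp only [matrixPow]
  rw [← cfc_comp' _ _ A (hcont' _ _) (hcont _) hsa, ← cfc_comp' _ _ A (hcont' _ _) (hcont _) hsa,
    ← cfc_mul _ _ A (hcont _) (hcont _)]
  exact cfc_congr fun x hx =>
    c.scalarPow_scalarPow_mul (spectrum_nonneg_of_nonneg hA.nonneg hx) hs ht ha hb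

end ZeroPowConvention

end ZeroPow

/-! ### The norm inequality in both conventions -/

section Interpolation

open Matrix

variable {m : ℕ} {N : Seminorm ℂ (Matrix (Fin m) (Fin m) ℂ)}

theorem absPow_eq_zero_iff {X : Matrix (Fin m) (Fin m) ℂ} {r : ℝ} (hr : 0 < r) :
    absPow X r = 0 ↔ X = 0 := by
  obtain ⟨U, hU, a, -, ha, hX⟩ := exists_conjTranspose_mul_self_eq_diagonal X
  have hU' : IsUnit U := (Unitary.toUnits ⟨U, hU⟩).isUnit
  have hU'' : IsUnit Uᴴ := (Unitary.toUnits ⟨Uᴴ, Unitary.star_mem hU⟩).isUnit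
  have h0 (f : ℝ → ℝ) : U * diagonal (fun i => (f (a i) : ℂ)) * Uᴴ = 0 ↔ ∀ i, f (a i) = 0 := by
    rw [hU''.mul_left_eq_zero, hU'.mul_right_eq_zero, diagonal_eq_zero, funext_iff]
    simp
  rw [absPow_eq_of_conjTranspose_mul_self hU ha hX, h0 (· ^ r), ← conjTranspose_mul_self_eq_zero,
    hX, h0 (· ^ 2)]
  refine forall_congr' fun i => ?_
  rw [Real.rpow_eq_zero (ha i) hr.ne', pow_eq_zero_iff two_ne_zero]

variable {A₁ A₂ B₁ B₂ : Matrix (Fin m) (Fin m) ℂ} {r θ : ℝ}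

theorem IsUnitarilyInvariantNorm.map_absPow_support_le (hN : IsUnitarilyInvariantNorm N)
    (hr : 0 < r) (hA₁ : A₁.PosSemidef) (hA₂ : A₂.PosSemidef) (hB₁ : B₁.PosSemidef)
    (hB₂ : B₂.PosSemidef) (hA : Commute A₁ A₂) (hB : Commute B₁ B₂) (h0 : 0 ≤ θ) (h1 : θ ≤ 1) :
    N (absPow ((ZeroPowConvention.support.matrixPow A₁ θ *
        ZeroPowConvention.support.matrixPow A₂ (1 - θ)) *
          (ZeroPowConvention.support.matrixPow B₁ θ *
            ZeroPowConvention.support.matrixPow B₂ (1 - θ))) r) ≤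
      N (absPow (A₁ * B₁) r) ^ θ * N (absPow (A₂ * B₂) r) ^ (1 - θ) :=
  hN.map_absPow_le_of_norm_det_le hr h0 h1 fun _ _ _ hβ hγ _ _ hP hQ =>
    norm_det_matrixPow_le_interpolation hA₁ hA₂ hB₁ hB₂ hA hB h0 h1 hβ hγ hP hQ

/-- Needed because a vanishing norm on the right has zeroth power `0` in the support convention, so
the left side must vanish too. -/
theorem ZeroPowConvention.support_matrixPow_mul_eq_zero (hA₁ : A₁.PosSemidef)
    (hA₂ : A₂.PosSemidef) (hB₁ : B₁.PosSemidef) (hB₂ : B₂.PosSemidef) (hA : Commute A₁ A₂)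
    (hB : Commute B₁ B₂) (h : A₁ * B₁ = 0 ∨ A₂ * B₂ = 0) (θ : ℝ) :
    (support.matrixPow A₁ θ * support.matrixPow A₂ (1 - θ)) *
      (support.matrixPow B₁ θ * support.matrixPow B₂ (1 - θ)) = 0 := by
  rw [← hA₁.suppCPow_ofReal, ← hA₂.suppCPow_ofReal, ← hB₁.suppCPow_ofReal,
    ← hB₂.suppCPow_ofReal, Complex.ofReal_sub, Complex.ofReal_one]
  rcases h with h | h
  · rw [suppCPow_mul_eq_left_mul_right_of_commute_left hA₁ hA₂ hB₁ hB₂ hA, h, Matrix.mul_zero,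
      Matrix.zero_mul]
  · rw [suppCPow_mul_eq_left_mul_right_of_commute_right hA₁ hA₂ hB₁ hB₂ hB, h, Matrix.mul_zero,
      Matrix.zero_mul]

theorem IsUnitarilyInvariantNorm.map_absPow_matrixPow_le (hN : IsUnitarilyInvariantNorm N)
    (c : ZeroPowConvention) (hr : 0 < r) (hA₁ : A₁.PosSemidef) (hA₂ : A₂.PosSemidef)
    (hB₁ : B₁.PosSemidef) (hB₂ : B₂.PosSemidef) (hA : Commute A₁ A₂) (hB : Commute B₁ B₂)
    (h0 : 0 ≤ θ) (h1 : θ ≤ 1) :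
    N (absPow ((c.matrixPow A₁ θ * c.matrixPow A₂ (1 - θ)) *
        (c.matrixPow B₁ θ * c.matrixPow B₂ (1 - θ))) r) ≤
      c.scalarPow (N (absPow (A₁ * B₁) r)) θ * c.scalarPow (N (absPow (A₂ * B₂) r)) (1 - θ) := by
  have key := hN.map_absPow_support_le hr hA₁ hA₂ hB₁ hB₂ hA hB h0 h1
  cases c with
  | identity =>
    rcases h0.eq_or_lt with rfl | h0
    · simp [ZeroPowConvention.identity_matrixPow_zero, ZeroPowConvention.identity_matrixPow_one,
        ZeroPowConvention.scalarPow, hA₁, hA₂, hB₁, hB₂]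
    rcases h1.eq_or_lt with rfl | h1
    · simp [ZeroPowConvention.identity_matrixPow_zero, ZeroPowConvention.identity_matrixPow_one,
        ZeroPowConvention.scalarPow, hA₁, hA₂, hB₁, hB₂]
    simpa only [ZeroPowConvention.matrixPow_of_pos _ _ h0,
      ZeroPowConvention.matrixPow_of_pos _ _ (sub_pos.2 h1), ZeroPowConvention.scalarPow_of_pos _ _ h0,
      ZeroPowConvention.scalarPow_of_pos _ _ (sub_pos.2 h1)] using key
  | support =>
    by_cases hzero : A₁ * B₁ = 0 ∨ A₂ * B₂ = 0
    · rw [ZeroPowConvention.support_matrixPow_mul_eq_zero hA₁ hA₂ hB₁ hB₂ hA hB hzero,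
        (absPow_eq_zero_iff hr).2 rfl, map_zero]
      exact mul_nonneg (ZeroPowConvention.scalarPow_nonneg _ (apply_nonneg N _) _)
        (ZeroPowConvention.scalarPow_nonneg _ (apply_nonneg N _) _)
    -- Definiteness of the norm makes both scalar bases nonzero, where the support convention is the
    -- ordinary power.
    · have hne {X : Matrix (Fin m) (Fin m) ℂ} (hX : X ≠ 0) : N (absPow X r) ≠ 0 := fun h =>
        hX ((absPow_eq_zero_iff hr).1 (hN.eq_zero_of_map_eq_zero _ h))
      rw [not_or] at hzero
      simpa only [ZeroPowConvention.scalarPow, hne hzero.1, hne hzero.2, if_false] using key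

end Interpolation

theorem corollary2p3 (m : ℕ) (N : Seminorm ℂ (Matrix (Fin m) (Fin m) ℂ))
    (hN : IsUnitarilyInvariantNorm N) (c : ZeroPowConvention) (r : ℝ) (hr : 0 < r) :
    (∀ A₁ A₂ B₁ B₂ : Matrix (Fin m) (Fin m) ℂ,
      A₁.PosSemidef → A₂.PosSemidef → B₁.PosSemidef → B₂.PosSemidef →
      A₁ * A₂ = A₂ * A₁ → B₁ * B₂ = B₂ * B₁ →
      ∀ θ : ℝ, 0 ≤ θ → θ ≤ 1 →
        N (absPow ((c.matrixPow A₁ θ * c.matrixPow A₂ (1 - θ)) *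
            (c.matrixPow B₁ θ * c.matrixPow B₂ (1 - θ))) r) ≤
          c.scalarPow (N (absPow (A₁ * B₁) r)) θ *
            c.scalarPow (N (absPow (A₂ * B₂) r)) (1 - θ)) ∧
    (∀ A B : Matrix (Fin m) (Fin m) ℂ, A.PosSemidef → B.PosSemidef →
      LogConvexOn (Set.Ici (0 : ℝ) ×ˢ Set.Ici (0 : ℝ))
        (fun p : ℝ × ℝ => N (absPow (c.matrixPow A p.1 * c.matrixPow B p.2) r))) := by
  refine ⟨fun A₁ A₂ B₁ B₂ hA₁ hA₂ hB₁ hB₂ hA hB θ h0 h1 =>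
    hN.map_absPow_matrixPow_le c hr hA₁ hA₂ hB₁ hB₂ hA hB h0 h1, fun A B hA hB =>
    ⟨(convex_Ici 0).prod (convex_Ici 0), fun _ _ => apply_nonneg N _, ?_⟩⟩
  rintro ⟨s, s'⟩ ⟨hs, hs'⟩ ⟨t, t'⟩ ⟨ht, ht'⟩ a b ha hb hab
  obtain rfl : b = 1 - a := by linarith
  -- The first inequality at `A^s, A^t` and `B^s', B^t'`, with `θ = a`; since `a` and `1 - a` are
  -- positive, the exponents combine in either convention.
  have key := hN.map_absPow_matrixPow_le c hr (c.posSemidef_matrixPow hA s)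
    (c.posSemidef_matrixPow hA t) (c.posSemidef_matrixPow hB s') (c.posSemidef_matrixPow hB t')
    (cfc_commute_cfc _ _ A) (cfc_commute_cfc _ _ B) ha.le (by linarith)
  rwa [c.matrixPow_matrixPow_mul hA hs ht ha hb, c.matrixPow_matrixPow_mul hB hs' ht' ha hb,
    c.scalarPow_of_pos _ ha, c.scalarPow_of_pos _ hb] at key
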